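/- Let $U,R,\Delta$ be finite sets of users, routers ($R\neq\emptyset$) and destinations, $A\subseteq R$ the compromised routers, $l\ge 2$, and let $p^u$ be a probability distribution on $\Delta$ for every $u\in U$. **I/O-automata model.** A configuration $C$ gives every user $u$ routers $(r^u_1,\dots,r^u_l)\in R^l$, a destination $d^u\in\Delta$ and a circuit identifier $n^u\in\mathbb{N}_+$; put $C_0(u)=u$, $C_j(u)=r^u_j$ for $1\le j\le l$, $C_{l+1}(u)=d^u$. Users and destinations are never compromised. An execution is a configuration together with a finite sequence of states and actions, consistent with it, of the following automata, which are connected by FIFO channels. Each user builds her circuit hop by hop with layered encryption (one key per hop): a CREATE message to the first router, then EXTEND messages which make the last hop so far send a CREATE message to the next one, up to the destination, each after the confirmation of the previous one. Honest routers and the destinations keep routing tables, peel or add one layer, and forward. Compromised routers may send anything that can be derived from the messages they have jointly received and their own keys. The adversary sees the send and receive actions of the compromised routers. He also recognizes, as by timing patterns, which of these actions belong to the same circuit, and at which link of it. Executions $e,e'$ are *indistinguishable* if, for some permutation $\pi$ of $U$, the sequence of actions seen in $e'$ arises from that of $e$ by renaming the owners of keys and circuits with $\pi$ and by a permutation of the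 message contents that respects their structure except inside ciphertexts under keys that the adversary does not hold. Configurations $C,D$ are *equivalent* if there is a permutation $\pi$ of $U$ with $C_j(u)=D_j(\pi(u))$ whenever $C_j(u)$ or $D_j(\pi(u))$ is compromised or next to a compromised hop of its circuit, and such that the identifiers of $u$ in $C$ and of $\pi(u)$ in $D$ agree whenever $C_1(u)\in A$. Let $E$ be a random execution with configuration $X^a$ such that 1. in $X^a$ all routers are independent and uniform on $R$, the destinations are independent with $d^u\sim p^u$, and the identifiers are independent of routers and destinations (with any joint law); 2. if $C,D$ are equivalent configurations of positive probability, then indistinguishable executions of $C$ and $D$ are equally probable given their configuration: for every execution $e$, $\Pr[E \text{ is indistinguishable from } e\mid X^a=C]=\Pr[E \text{ is indistinguishable from } e\mid X^a=D]$; 3. almost surely all circuits are established: for all $u$ and $0\le j\le l$, the CREATE message for hop $j+1$ of $u$'s circuit is received by that hop from hop $j$. **Black-box model.** Let $b=|A|/|R|$. In a random configuration $X^b$ every user $u$ independently has a destination $X^b_D(u)\sim p^u$, an input that is observed with probability $b$, and, independently, an output that is observed with probability $b$. For each user $u$ the adversary receives the pair whose first entry is $u$ if the input of $u$ is observed and $\bot$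 otherwise, and whose second entry is the destination of $u$ if the output of $u$ is observed and $\bot$ otherwise. Two black-box configurations are indistinguishable if he receives the same multiset of pairs. Let $\psi_1(u,d,e)$ be the conditional probability that $u$'s destination in $X^a$ is $d$, given that $E$ is indistinguishable from $e$, and let $\psi_2(u,d,c)$ be the conditional probability that $X^b_D(u)=d$, given that $X^b$ is indistinguishable from $c$. Then for every family $\psi_0(u,d)$ of real numbers $$\Pr[\forall u\in U,\,d\in\Delta:\ \psi_1(u,d,E)=\psi_0(u,d)]=\Pr[\forall u\in U,\,d\in\Delta:\ \psi_2(u,d,X^b)=\psi_0(u,d)].$$ -/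

import Mathlib

open scoped ENNReal

namespace OnionRouting

universe uU uR uD

/-! ## Discrete probability -/

/-- The probability that a random draw from `μ` lies in `s`. -/
noncomputable def prob {α : Type*} (μ : PMF α) (s : Set α) : ℝ :=
  (μ.toOuterMeasure s).toReal

/-- The elementary conditional probability of `s` given `t`. -/
noncomputable def condProb {α : Type*} (μ : PMF α) (s t : Set α) : ℝ :=
  prob μ (s ∩ t) / prob μ t

/-- Independent draws, one from each `p u`. -/
noncomputable def pmfPi {U β : Type*} [Fintype U] [DecidableEq U] [Fintype β]
    (p : U → PMF β) : PMF (U → β) :=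
  PMF.ofFintype (fun c => ∏ u, p u (c u)) (by
    rw [← Fintype.prod_sum (fun u x => p u x)]
    refine Finset.prod_eq_one fun u _ => ?_
    rw [← tsum_fintype (L := .unconditional β)]
    exact (p u).tsum_coe)

/-! ## The black-box model -/

/-- A black-box configuration: destinations, observed inputs, observed outputs. -/
structure BBConfig (U : Type uU) (Δ : Type uD) where
  dest : U → Δ
  inObs : U → Bool
  outObs : U → Bool

/-- The functionality's choice, for one user, of what to reveal: the first bit says whether the
input is revealed, the second whether the output is. The four outcomes have probabilities
`(1-b)(1-b)`, `b(1-b)`, `(1-b)b` and `b*b`. -/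
noncomputable def revealLaw (b : ℝ≥0∞) (hb : b ≤ 1) : PMF (Bool × Bool) :=
  PMF.ofFintype
    (fun x => match x with
      | (false, false) => (1 - b) * (1 - b)
      | (true, false) => b * (1 - b)
      | (false, true) => (1 - b) * b
      | (true, true) => b * b)
    (by
      have h : b + (1 - b) = 1 := add_tsub_cancel_of_le hb
      rw [Fintype.sum_prod_type]
      simp only [Fintype.sum_bool]
      rw [← mul_add, ← mul_add, h, mul_one, mul_one, h])

/-- The law of a random black-box configuration. -/
noncomputable def bbLaw {U : Type uU} {Δ : Type uD} [Fintype U] [DecidableEq U] [Fintype Δ]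
    (b : ℝ≥0∞) (hb : b ≤ 1) (p : U → PMF Δ) : PMF (BBConfig U Δ) :=
  (pmfPi p).bind fun d => (pmfPi fun _ : U => revealLaw b hb).bind fun x =>
    PMF.pure ⟨d, fun u => (x u).1, fun u => (x u).2⟩

/-- The message about `u` that the adversary receives; `none` stands for `⊥`. -/
def BBConfig.message {U : Type uU} {Δ : Type uD} (c : BBConfig U Δ) (u : U) :
    Option U × Option Δ :=
  (if c.inObs u then some u else none, if c.outObs u then some (c.dest u) else none)

/-- Two black-box configurations are indistinguishable when the adversary receives the same
inputs, outputs and links between them, i.e. the same (unordered) collection of messages. -/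
def BBConfig.Indist {U : Type uU} {Δ : Type uD} [Fintype U] (c c' : BBConfig U Δ) : Prop :=
  (Finset.univ.val.map c.message) = (Finset.univ.val.map c'.message)

/-- The posterior probability that `u` visits `d` given that the random configuration is
indistinguishable from `c`. -/
noncomputable def bbPosterior {U : Type uU} {Δ : Type uD} [Fintype U] (μ : PMF (BBConfig U Δ))
    (u : U) (d : Δ) (c : BBConfig U Δ) : ℝ :=
  condProb μ {x | x.dest u = d} {x | c.Indist x}

/-! ## Configurations of the I/O-automata model -/

/-- A configuration: every user's circuit of `l` routers, destination and circuit identifier. -/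
structure IOConfig (U : Type uU) (R : Type uR) (Δ : Type uD) (l : ℕ) where
  routers : U → Fin l → R
  dest : U → Δ
  id : U → ℕ+

/-- The law of a random configuration: all routers uniform and independent, independent
destinations with law `p u` for user `u`, and identifiers drawn, independently of routers and
destinations, from some law `ρ`. -/
noncomputable def ioConfigLaw {U : Type uU} {R : Type uR} {Δ : Type uD} [Fintype U]
    [DecidableEq U] [Fintype R] [Nonempty R] [Fintype Δ] (l : ℕ) (p : U → PMF Δ)
    (ρ : PMF (U → ℕ+)) : PMF (IOConfig U R Δ l) :=
  (pmfPi fun _ : U => pmfPi fun _ : Fin l => PMF.uniformOfFintype R).bind fun r =>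
    (pmfPi p).bind fun d => ρ.bind fun n => PMF.pure ⟨r, d, n⟩

/-- The processes: users, routers, and destinations. A destination is the last, always
uncompromised, router of a circuit. -/
inductive Agent (U : Type uU) (R : Type uR) (Δ : Type uD) where
  | user (u : U)
  | router (r : R)
  | dest (d : Δ)
  deriving DecidableEq

/-- Only routers can be compromised. -/
def isComp {U : Type uU} {R : Type uR} {Δ : Type uD} [DecidableEq R] (A : Finset R) :
    Agent U R Δ → Bool
  | .router r => decide (r ∈ A)
  | _ => false

/-- The `j`-th agent on `u`'s circuit: the user for `j = 0`, the routers for `1 ≤ j ≤ l`, the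
destination for `j = l + 1`. -/
def IOConfig.hop {U : Type uU} {R : Type uR} {Δ : Type uD} {l : ℕ} (C : IOConfig U R Δ l)
    (u : U) : ℕ → Agent U R Δ
  | 0 => .user u
  | j + 1 => if h : j < l then .router (C.routers u ⟨j, h⟩) else .dest (C.dest u)

/-- The adversary observes hop `j` of `u`'s circuit: it is compromised or next to a compromised
hop of the circuit. -/
def IOConfig.Observed {U : Type uU} {R : Type uR} {Δ : Type uD} {l : ℕ} [DecidableEq R]
    (A : Finset R) (C : IOConfig U R Δ l) (u : U) (j : ℕ) : Prop :=
  isComp A (C.hop u j) ∨ isComp A (C.hop u (j + 1)) ∨ ∃ i, j = i + 1 ∧ isComp A (C.hop u i)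

/-- The equivalence class of circuit and destination choices: `C` and `D` agree, up to a
permutation of the users, on every hop that the adversary observes in one of them, and on the
identifiers of the circuits whose first router is compromised. The user is itself hop `0`, so
the permutation fixes the users whose first router is compromised. -/
def IOConfig.Equiv {U : Type uU} {R : Type uR} {Δ : Type uD} {l : ℕ} [DecidableEq R]
    (A : Finset R) (C D : IOConfig U R Δ l) : Prop :=
  ∃ π : Equiv.Perm U,
    (∀ u j, j ≤ l + 1 → C.Observed A u j ∨ D.Observed A (π u) j → C.hop u j = D.hop (π u) j) ∧
    ∀ u, isComp A (C.hop u 1) → C.id u = D.id (π u)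

/-! ## Messages -/

/-- The `idx`-th key that user `owner` shares with agent `node`. -/
structure Key (U : Type uU) (R : Type uR) (Δ : Type uD) where
  owner : U
  node : Agent U R Δ
  idx : ℕ
  deriving DecidableEq

/-- Symbolic message contents; `enc k p` is `p` encrypted under `k`. -/
inductive Payload (U : Type uU) (R : Type uR) (Δ : Type uD) where
  | create
  | created
  | extend (next : Agent U R Δ) (p : Payload U R Δ)
  | extended
  | enc (k : Key U R Δ) (p : Payload U R Δ)
  deriving DecidableEq

/-- Away from the user or back towards the user. -/
inductive Dir where
  | fwd
  | back
  deriving DecidableEq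

/-- A packet on a link: the identifier of the circuit on that link, direction and contents. -/
structure Packet (U : Type uU) (R : Type uR) (Δ : Type uD) where
  id : ℕ+
  dir : Dir
  payload : Payload U R Δ
  deriving DecidableEq

/-- What the adversary can build from the contents `K` that compromised routers have received:
it can encrypt and decrypt exactly with the keys of compromised routers. -/
inductive Derivable {U : Type uU} {R : Type uR} {Δ : Type uD} [DecidableEq R] (A : Finset R)
    (K : List (Payload U R Δ)) : Payload U R Δ → Prop where
  | known {p} : p ∈ K → Derivable A K p
  | create : Derivable A K .create
  | created : Derivable A K .created
  | extended : Derivable A K .extended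
  | extend {s p} : Derivable A K p → Derivable A K (.extend s p)
  | extendInv {s p} : Derivable A K (.extend s p) → Derivable A K p
  | enc {k p} : isComp A k.node → Derivable A K p → Derivable A K (.enc k p)
  | dec {k p} : isComp A k.node → Derivable A K (.enc k p) → Derivable A K p

/-! ## The protocol automata -/

section Protocol

variable {U : Type uU} {R : Type uR} {Δ : Type uD} {l : ℕ}
  [DecidableEq U] [DecidableEq R] [DecidableEq Δ]

/-- The key of hop `j` on `u`'s circuit. -/
def IOConfig.key (C : IOConfig U R Δ l) (u : U) (j : ℕ) : Key U R Δ := ⟨u, C.hop u j, j⟩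

/-- `p` under the layers of the first `j` hops, the first hop outermost. -/
def IOConfig.wrap (C : IOConfig U R Δ l) (u : U) : ℕ → Payload U R Δ → Payload U R Δ
  | 0, p => p
  | j + 1, p => C.wrap u j (.enc (C.key u (j + 1)) p)

/-- The request that makes hop `j` extend `u`'s circuit to hop `j + 1` (for `j = 0`, that opens
the circuit at the first hop). -/
def IOConfig.request (C : IOConfig U R Δ l) (u : U) : ℕ → Packet U R Δ
  | 0 => ⟨C.id u, .fwd, .enc (C.key u 1) .create⟩
  | j + 1 => ⟨C.id u, .fwd, C.wrap u (j + 1)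
      (.extend (C.hop u (j + 2)) (.enc (C.key u (j + 2)) .create))⟩

/-- The confirmation of the request with the same number. -/
def IOConfig.confirmation (C : IOConfig U R Δ l) (u : U) : ℕ → Packet U R Δ
  | 0 => ⟨C.id u, .back, .created⟩
  | j + 1 => ⟨C.id u, .back, C.wrap u (j + 1) .extended⟩

/-- The reaction of user `u`, who has sent the requests with numbers below `stage`: a
confirmation of the last request from the first hop makes her send the next one, until the
circuit reaches its destination. Everything else is ignored. The result is the new stage and the
packets to send. -/
def IOConfig.userReact (C : IOConfig U R Δ l) (u : U) (stage : ℕ) (q : Agent U R Δ)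
    (m : Packet U R Δ) : ℕ × List (Agent U R Δ × Packet U R Δ) :=
  if 1 ≤ stage ∧ stage ≤ l + 1 ∧ q = C.hop u 1 ∧ m = C.confirmation u (stage - 1) then
    (stage + 1, if stage ≤ l then [(C.hop u 1, C.request u stage)] else [])
  else (stage, [])

/-- An entry of a router's table: a circuit that arrives from `prev` with identifier `prevId`
and key `key`, and leaves, once it has been extended, over `next`; `confirmed` says whether the
next router has confirmed. -/
structure Entry (U : Type uU) (R : Type uR) (Δ : Type uD) where
  prev : Agent U R Δ
  prevId : ℕ+
  key : Key U R Δ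
  next : Option (Agent U R Δ × ℕ+)
  confirmed : Bool
  deriving DecidableEq

/-- The least identifier not yet used for circuits that leave towards `s`. Entries are never
removed and outgoing identifiers are only assigned by this rule, so those in use are
`1, …, k`, where `k` is their number. -/
def freshId (T : List (Entry U R Δ)) (s : Agent U R Δ) : ℕ+ :=
  Nat.succPNat (T.countP fun t => decide (t.next.map Prod.fst = some s))

/-- The table with entry `t` replaced by `t'`. -/
def replaceEntry (T : List (Entry U R Δ)) (t t' : Entry U R Δ) : List (Entry U R Δ) :=
  T.map fun x => if x = t then t' else x

/-- The reaction of the honest router (or destination) `self` with table `T` to the packet `m`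
from `q`: the new table and the packets to send. -/
def routerReact (self : Agent U R Δ) (T : List (Entry U R Δ)) (q : Agent U R Δ)
    (m : Packet U R Δ) : List (Entry U R Δ) × List (Agent U R Δ × Packet U R Δ) :=
  match m.dir with
  | .fwd =>
    match T.find? (fun t => decide (t.prev = q ∧ t.prevId = m.id)) with
    | none =>
      match m.payload with
      | .enc k .create =>
        if k.node = self then (⟨q, m.id, k, none, false⟩ :: T, [(q, ⟨m.id, .back, .created⟩)])
        else (T, [])
      | _ => (T, [])
    | some t =>
      match m.payload with
      | .enc k p =>
        if k = t.key then
          match t.next with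
          | none =>
            match p with
            | .extend s p' =>
              (replaceEntry T t { t with next := some (s, freshId T s) },
                [(s, ⟨freshId T s, .fwd, p'⟩)])
            | _ => (T, [])
          | some (s, n) => if t.confirmed then (T, [(s, ⟨n, .fwd, p⟩)]) else (T, [])
        else (T, [])
      | _ => (T, [])
  | .back =>
    match T.find? (fun t => decide (t.next = some (q, m.id))) with
    | none => (T, [])
    | some t =>
      if t.confirmed then (T, [(t.prev, ⟨t.prevId, .back, .enc t.key m.payload⟩)])
      else if m.payload = .created then
        (replaceEntry T t { t with confirmed := true },
          [(t.prev, ⟨t.prevId, .back, .enc t.key .extended⟩)])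
      else (T, [])

/-- A state of the composed system: the users' stages, the tables of routers and destinations,
the packets that honest agents are about to send, the FIFO channels, and the contents that
compromised routers have received. -/
structure State (U : Type uU) (R : Type uR) (Δ : Type uD) where
  stage : U → ℕ
  table : Agent U R Δ → List (Entry U R Δ)
  outbox : Agent U R Δ → List (Agent U R Δ × Packet U R Δ)
  chan : Agent U R Δ → Agent U R Δ → List (Packet U R Δ)
  known : List (Payload U R Δ)

/-- The initial state. -/
def State.init : State U R Δ := ⟨fun _ => 0, fun _ => [], fun _ => [], fun _ _ => [], []⟩

/-- The actions: a user starts, `q` sends `m` to `r` (into the channel), `r` receives `m` from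
`q` (out of the channel). -/
inductive Action (U : Type uU) (R : Type uR) (Δ : Type uD) where
  | start (u : U)
  | send (q r : Agent U R Δ) (m : Packet U R Δ)
  | receive (q r : Agent U R Δ) (m : Packet U R Δ)

/-- The state with the channel from `q` to `r` set to `x`. -/
def State.setChan (s : State U R Δ) (q r : Agent U R Δ) (x : List (Packet U R Δ)) :
    State U R Δ :=
  { s with chan := Function.update s.chan q (Function.update (s.chan q) r x) }

/-- The effect on the recipient of receiving `m` from `q`. Compromised routers only store what
they receive. -/
def State.deliver (C : IOConfig U R Δ l) (A : Finset R) (s : State U R Δ) (q r : Agent U R Δ)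
    (m : Packet U R Δ) : State U R Δ :=
  if isComp A r then { s with known := m.payload :: s.known }
  else
    match r with
    | .user u =>
      let x := C.userReact u (s.stage u) q m
      { s with stage := Function.update s.stage u x.1
               outbox := Function.update s.outbox r (s.outbox r ++ x.2) }
    | r =>
      let x := routerReact r (s.table r) q m
      { s with table := Function.update s.table r x.1
               outbox := Function.update s.outbox r (s.outbox r ++ x.2) }

/-- The transitions of the system in configuration `C`. Honest agents follow the protocol.
Compromised routers can at any time send whatever they can jointly derive, so that every choice
of colluding adversary automata (which cannot break the encryption) is covered, whether or not
they follow the protocol. -/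
inductive Step (C : IOConfig U R Δ l) (A : Finset R) :
    State U R Δ → Action U R Δ → State U R Δ → Prop where
  | start (s : State U R Δ) (u : U) : s.stage u = 0 →
      Step C A s (.start u)
        { s with stage := Function.update s.stage u 1
                 outbox := Function.update s.outbox (.user u)
                   (s.outbox (.user u) ++ [(C.hop u 1, C.request u 0)]) }
  | send (s : State U R Δ) (q r : Agent U R Δ) (m : Packet U R Δ)
      (rest : List (Agent U R Δ × Packet U R Δ)) : isComp A q = false →
      s.outbox q = (r, m) :: rest →
      Step C A s (.send q r m)
        { s.setChan q r (s.chan q r ++ [m]) with outbox := Function.update s.outbox q rest }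
  | inject (s : State U R Δ) (q r : Agent U R Δ) (m : Packet U R Δ) : isComp A q = true →
      Derivable A s.known m.payload →
      Step C A s (.send q r m) (s.setChan q r (s.chan q r ++ [m]))
  | receive (s : State U R Δ) (q r : Agent U R Δ) (m : Packet U R Δ)
      (rest : List (Packet U R Δ)) : s.chan q r = m :: rest →
      Step C A s (.receive q r m) ((s.setChan q r rest).deliver C A q r m)

/-- The alternating sequence of actions and states is possible from the given state. -/
inductive IsRun (C : IOConfig U R Δ l) (A : Finset R) :
    State U R Δ → List (Action U R Δ × State U R Δ) → Prop where
  | nil (s : State U R Δ) : IsRun C A s []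
  | cons {s s' : State U R Δ} {a : Action U R Δ} {e : List (Action U R Δ × State U R Δ)} :
      Step C A s a s' → IsRun C A s' e → IsRun C A s ((a, s') :: e)

variable (U R Δ l) in
/-- An execution: a configuration and a sequence of actions and states, from the initial state,
consistent with the configuration. -/
structure Execution (A : Finset R) where
  config : IOConfig U R Δ l
  run : List (Action U R Δ × State U R Δ)
  isRun : IsRun config A State.init run

/-- The sequence of actions of an execution. -/
def Execution.actions {A : Finset R} (e : Execution U R Δ l A) : List (Action U R Δ) :=
  e.run.map Prod.fst

/-- All circuits are established: over every link of every circuit the packet that creates the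
next hop has been received. -/
def Execution.Established {A : Finset R} (e : Execution U R Δ l A) : Prop :=
  ∀ u j, j ≤ l → ∃ n : ℕ+, Action.receive (e.config.hop u j) (e.config.hop u (j + 1))
    ⟨n, .fwd, .enc (e.config.key u (j + 1)) .create⟩ ∈ e.actions

/-! ## What the adversary sees -/

/-- The adversary sees exactly the actions of compromised routers. -/
def Action.isVisible (A : Finset R) : Action U R Δ → Bool
  | .start _ => false
  | .send q _ _ => isComp A q
  | .receive _ r _ => isComp A r

/-- The sequence of actions that the adversary sees. -/
def Execution.visible {A : Finset R} (e : Execution U R Δ l A) : List (Action U R Δ) :=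
  e.actions.filter (Action.isVisible A)

/-- The key whose owner has been renamed. -/
def Key.rename (π : Equiv.Perm U) (k : Key U R Δ) : Key U R Δ := { k with owner := π k.owner }

variable (U R Δ) in
/-- A relabelling of message contents that the adversary cannot detect. Routers do not know
which of their keys belongs to which user, so key owners may be permuted; a ciphertext under a
key that the adversary does not hold may be replaced by another one for the renamed owner; the
rest of the structure is preserved. -/
structure Relabelling (A : Finset R) where
  π : Equiv.Perm U
  ξ : Equiv.Perm (Payload U R Δ)
  map_create : ξ .create = .create
  map_created : ξ .created = .created
  map_extended : ξ .extended = .extended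
  map_extend : ∀ s p, ξ (.extend s p) = .extend s (ξ p)
  map_enc_known : ∀ k p, isComp A k.node = true → ξ (.enc k p) = .enc (k.rename π) (ξ p)
  map_enc_unknown : ∀ k p, isComp A k.node = false →
    ∃ k' p', ξ (.enc k p) = .enc k' p' ∧ k'.owner = π k.owner ∧ isComp A k'.node = false

/-- The relabelled action: sender, recipient, identifier and direction stay the same. -/
def Relabelling.act {A : Finset R} (ρ : Relabelling U R Δ A) : Action U R Δ → Action U R Δ
  | .start u => .start u
  | .send q r m => .send q r { m with payload := ρ.ξ m.payload }
  | .receive q r m => .receive q r { m with payload := ρ.ξ m.payload }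

/-- The packet is encrypted under a key of `u` and travels over the `j`-th link of `u`'s
circuit (the one between hops `j` and `j + 1`), in the right direction. -/
def IOConfig.Carries (C : IOConfig U R Δ l) (u : U) (j : ℕ) (q r : Agent U R Δ)
    (m : Packet U R Δ) : Prop :=
  (∃ k p, m.payload = .enc k p ∧ k.owner = u) ∧
    match m.dir with
    | .fwd => q = C.hop u j ∧ r = C.hop u (j + 1)
    | .back => q = C.hop u (j + 1) ∧ r = C.hop u j

/-- The action moves a packet over the `j`-th link of `u`'s circuit. -/
def Action.OnLink (C : IOConfig U R Δ l) (u : U) (j : ℕ) : Action U R Δ → Prop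
  | .start _ => False
  | .send q r m => C.Carries u j q r m
  | .receive q r m => C.Carries u j q r m

/-- Two executions are indistinguishable to the adversary: the actions that he sees in one are,
one by one, a relabelling of those that he sees in the other. By comparing timing patterns the
adversary recognizes which of the packets that he handles are part of the same connection, and
at which link, so the relabelling has to preserve this, with the users permuted. -/
def Execution.Indist {A : Finset R} (e e' : Execution U R Δ l A) : Prop :=
  ∃ ρ : Relabelling U R Δ A, List.Forall₂
    (fun a a' => a' = ρ.act a ∧
      ∀ u j, j ≤ l → (a.OnLink e.config u j ↔ a'.OnLink e'.config (ρ.π u) j))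
    e.visible e'.visible

/-- The condition on a law of executions that indistinguishable executions of equivalent
configurations are equally probable, conditional on their configuration. -/
def PairedEqually {A : Finset R} (μ : PMF (Execution U R Δ l A)) : Prop :=
  ∀ C D : IOConfig U R Δ l, C.Equiv A D →
    prob μ {x | x.config = C} ≠ 0 → prob μ {x | x.config = D} ≠ 0 →
    ∀ e : Execution U R Δ l A,
      condProb μ {x | e.Indist x} {x | x.config = C} =
        condProb μ {x | e.Indist x} {x | x.config = D}

/-- The posterior probability that `u` visits `d` given that the random execution is
indistinguishable from `e`. -/
noncomputable def ioPosterior {A : Finset R} (μ : PMF (Execution U R Δ l A)) (u : U) (d : Δ)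
    (e : Execution U R Δ l A) : ℝ :=
  condProb μ {x | x.config.dest u = d} {x | e.Indist x}

end Protocol

/-- The fraction of compromised routers. -/
noncomputable def compFraction {R : Type uR} [Fintype R] (A : Finset R) : ℝ≥0∞ :=
  (A.card : ℝ≥0∞) / (Fintype.card R : ℝ≥0∞)

theorem compFraction_le_one {R : Type uR} [Fintype R] (A : Finset R) : compFraction A ≤ 1 := by
  refine ENNReal.div_le_of_le_mul ?_
  rw [one_mul]
  exact_mod_cast A.card_le_univ

end OnionRouting

/-!
The adversary's knowledge is reduced in two steps, each an instance of one principle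
(`condProb_preimage_eq`): if an observation meets every fibre of a random variable `f` over a set
`K` in the same proportion, and no other fibre, then conditioning on it tells no more about `f`
than that its value lies in `K`.

From executions to configurations. On every link with a compromised end the adversary sees the
packet that creates the next hop, since all circuits are established and what is received has
been sent. An undetectable relabelling preserves sender, recipient, circuit and link of this
packet, and a packet from a user carries the identifier of her circuit. Hence indistinguishable
executions have equivalent configurations (`Execution.Indist.config_equiv`). Together with the
assumption that equivalent configurations produce indistinguishable executions with equal
probability, the principle shows that the posterior given the execution is the posterior given
the equivalence class of its configuration (`ioPosterior_eq_condProb_config`).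

From configurations to the black box. `IOConfig.toBB` keeps the destinations and whether the
first and the last router of each circuit are compromised. As these routers are different and
uniform, it maps the law of the configuration to that of the black box (`ioConfigLaw_map_toBB`).
Equivalent configurations have indistinguishable images. Conversely, if a permutation of the users
matches the messages of two black-box configurations, then handing the routers on along it turns
a configuration over the one into an equivalent configuration over the other; it fixes every user
whose identifier is observed, and it preserves the law of routers and identifiers. So an
equivalence class meets all fibres over indistinguishable black-box configurations in the same
proportion (`circuitLaw_fiber_eq`), and the principle identifies the posterior given the class
with the black-box posterior (`condProb_equiv_eq_bbPosterior`).

The posteriors thus agree along a map that carries one law to the other, so they have the same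
distribution.
-/

open scoped ENNReal

namespace OnionRouting

universe uU uR uD

/-! ### Discrete probability -/

theorem toOuterMeasure_le_one {α : Type*} (μ : PMF α) (s : Set α) : μ.toOuterMeasure s ≤ 1 := by
  rw [PMF.toOuterMeasure_apply, ← μ.tsum_coe]
  exact ENNReal.tsum_le_tsum fun x => Set.indicator_le_self s _ x

theorem toOuterMeasure_ne_top {α : Type*} (μ : PMF α) (s : Set α) : μ.toOuterMeasure s ≠ ∞ :=
  ((toOuterMeasure_le_one μ s).trans_lt ENNReal.one_lt_top).ne

theorem toOuterMeasure_ne_zero_of_mem {α : Type*} {μ : PMF α} {s : Set α} {a : α}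
    (ha : a ∈ μ.support) (hs : a ∈ s) : μ.toOuterMeasure s ≠ 0 := by
  rw [Ne, PMF.toOuterMeasure_apply_eq_zero_iff, Set.not_disjoint_iff]
  exact ⟨a, ha, hs⟩

theorem prob_congr {α : Type*} {μ : PMF α} {s t : Set α}
    (h : ∀ x ∈ μ.support, x ∈ s ↔ x ∈ t) : prob μ s = prob μ t := by
  unfold prob
  rw [PMF.toOuterMeasure_apply_eq_of_inter_support_eq μ]
  ext x
  simp only [Set.mem_inter_iff]
  constructor <;> rintro ⟨hs, hx⟩
  · exact ⟨(h x hx).1 hs, hx⟩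
  · exact ⟨(h x hx).2 hs, hx⟩

theorem prob_map {α β : Type*} (μ : PMF α) (f : α → β) (s : Set β) :
    prob (μ.map f) s = prob μ (f ⁻¹' s) := by
  simp only [prob, PMF.toOuterMeasure_map_apply]

/-- Total probability over the fibres of `f`. -/
theorem toOuterMeasure_eq_tsum_fiber {α β : Type*} (μ : PMF α) (f : α → β) (s : Set α) :
    μ.toOuterMeasure s = ∑' y, μ.toOuterMeasure (s ∩ f ⁻¹' {y}) := by
  classical
  simp only [PMF.toOuterMeasure_apply]
  rw [ENNReal.tsum_comm]
  refine tsum_congr fun x => ?_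
  rw [tsum_eq_single (f x)]
  · by_cases h : x ∈ s <;> simp [Set.indicator, h]
  · intro y hy
    simp [Set.indicator, hy.symm]

/-- An observation `S` that meets every fibre of `f` over `K` in the same proportion `q`, and no
other fibre, tells no more about `f` than that its value lies in `K`. -/
theorem condProb_preimage_eq {α β : Type*} (μ : PMF α) (f : α → β) (S : Set α) (K : Set β)
    (q : ℝ≥0∞) (hq0 : q ≠ 0) (hq : q ≠ ∞)
    (hK : ∀ y ∈ K, μ.toOuterMeasure (S ∩ f ⁻¹' {y}) = q * μ.toOuterMeasure (f ⁻¹' {y}))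
    (hKc : ∀ y ∉ K, μ.toOuterMeasure (S ∩ f ⁻¹' {y}) = 0) (T : Set β) :
    condProb μ (f ⁻¹' T) S = condProb (μ.map f) T K := by
  classical
  have key : ∀ T : Set β,
      μ.toOuterMeasure (f ⁻¹' T ∩ S) = q * (μ.map f).toOuterMeasure (T ∩ K) := by
    intro T
    rw [toOuterMeasure_eq_tsum_fiber μ f, PMF.toOuterMeasure_apply, ← ENNReal.tsum_mul_left]
    refine tsum_congr fun y => ?_
    by_cases hT : y ∈ T
    · have hs : f ⁻¹' T ∩ S ∩ f ⁻¹' {y} = S ∩ f ⁻¹' {y} := by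
        ext x
        simp only [Set.mem_inter_iff, Set.mem_preimage, Set.mem_singleton_iff]
        constructor
        · rintro ⟨⟨_, h⟩, h'⟩
          exact ⟨h, h'⟩
        · rintro ⟨h, rfl⟩
          exact ⟨⟨hT, h⟩, rfl⟩
      rw [hs]
      by_cases hy : y ∈ K
      · rw [hK y hy, Set.indicator_of_mem (show y ∈ T ∩ K from ⟨hT, hy⟩),
          ← PMF.toOuterMeasure_apply_singleton (μ.map f), PMF.toOuterMeasure_map_apply]
      · rw [hKc y hy, Set.indicator_of_notMem fun h => hy h.2, mul_zero]
    · have hs : f ⁻¹' T ∩ S ∩ f ⁻¹' {y} = ∅ := by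
        ext x
        simp only [Set.mem_inter_iff, Set.mem_preimage, Set.mem_singleton_iff,
          Set.mem_empty_iff_false, iff_false]
        rintro ⟨⟨h, _⟩, rfl⟩
        exact hT h
      rw [hs, Set.indicator_of_notMem fun h => hT h.1]
      simp
  have h0 := key Set.univ
  simp only [Set.preimage_univ, Set.univ_inter] at h0
  have hq' : q.toReal ≠ 0 := (ENNReal.toReal_pos hq0 hq).ne'
  simp only [condProb, prob, key T, h0, ENNReal.toReal_mul]
  exact mul_div_mul_left _ _ hq'

/-- Independent draws fall into a box with the product of the probabilities of its sides. -/
theorem pmfPi_toOuterMeasure_box {U β : Type*} [Fintype U] [DecidableEq U] [Fintype β]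
    (p : U → PMF β) (s : U → Set β) :
    (pmfPi p).toOuterMeasure {c | ∀ u, c u ∈ s u} = ∏ u, (p u).toOuterMeasure (s u) := by
  classical
  simp only [PMF.toOuterMeasure_apply_fintype]
  rw [Fintype.prod_sum]
  refine Finset.sum_congr rfl fun c _ => ?_
  simp only [Set.indicator, Set.mem_ofPred_eq]
  split_ifs with h
  · simp [pmfPi, h]
  · obtain ⟨u, hu⟩ := not_forall.1 h
    exact (Finset.prod_eq_zero (Finset.mem_univ u) (by simp [hu])).symm

theorem pmfPi_map {U β γ : Type*} [Fintype U] [DecidableEq U] [Fintype β] [Fintype γ]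
    (p : U → PMF β) (f : β → γ) :
    (pmfPi p).map (fun c u => f (c u)) = pmfPi fun u => (p u).map f := by
  ext c
  rw [← PMF.toOuterMeasure_apply_singleton, PMF.toOuterMeasure_map_apply]
  have hs : (fun (c : U → β) u => f (c u)) ⁻¹' {c} = {x | ∀ u, x u ∈ f ⁻¹' {c u}} := by
    ext x
    simp [funext_iff]
  rw [hs, pmfPi_toOuterMeasure_box]
  simp only [← PMF.toOuterMeasure_map_apply, PMF.toOuterMeasure_apply_singleton]
  rfl

theorem pmfPi_const_comp_perm {U β : Type*} [Fintype U] [DecidableEq U] [Fintype β]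
    (q : PMF β) (σ : Equiv.Perm U) :
    (pmfPi fun _ : U => q).map (fun c => c ∘ σ) = pmfPi fun _ : U => q := by
  ext c
  rw [← PMF.toOuterMeasure_apply_singleton, PMF.toOuterMeasure_map_apply]
  have hs : (fun x : U → β => x ∘ σ) ⁻¹' {c} = {c ∘ σ.symm} := by
    ext x
    simp only [Set.mem_preimage, Set.mem_singleton_iff]
    exact (Equiv.eq_comp_symm σ x c).symm
  rw [hs, PMF.toOuterMeasure_apply_singleton]
  exact Equiv.prod_comp σ.symm fun u => q (c u)

/-! ### The observed ends of a uniform circuit -/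

theorem uniform_toOuterMeasure_comp {R : Type uR} [Fintype R] [DecidableEq R] [Nonempty R]
    (A : Finset R) (x : Bool) :
    (PMF.uniformOfFintype R).toOuterMeasure {r | decide (r ∈ A) = x} =
      if x then compFraction A else 1 - compFraction A := by
  have hcard : ((Fintype.card R : ℕ) : ℝ≥0∞) ≠ 0 := by
    exact_mod_cast Fintype.card_ne_zero
  rw [PMF.toOuterMeasure_uniformOfFintype_apply]
  cases x
  · have h : Fintype.card {r | decide (r ∈ A) = false} = Fintype.card R - A.card := by
      rw [← Finset.card_compl, Fintype.card_of_finset' Aᶜ (by simp)]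
    rw [h, compFraction, ENNReal.natCast_sub, ENNReal.sub_div fun _ _ => hcard,
      ENNReal.div_self hcard (by simp)]
    simp
  · have h : Fintype.card {r | decide (r ∈ A) = true} = A.card := by
      rw [Fintype.card_of_finset' A (by simp)]
    rw [h]
    rfl

/-- Whether the first and the last router of a uniform circuit are compromised is distributed
like the bits of the black box, because these are two different routers. -/
theorem uniform_ends_map {R : Type uR} [Fintype R] [DecidableEq R] [Nonempty R]
    (A : Finset R) {l : ℕ} {i j : Fin l} (hij : i ≠ j) :
    (pmfPi fun _ : Fin l => PMF.uniformOfFintype R).map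
        (fun r => (decide (r i ∈ A), decide (r j ∈ A))) =
      revealLaw (compFraction A) (compFraction_le_one A) := by
  ext ⟨x, y⟩
  rw [← PMF.toOuterMeasure_apply_singleton, PMF.toOuterMeasure_map_apply]
  let s : Fin l → Set R := fun k =>
    if k = i then {r | decide (r ∈ A) = x} else if k = j then {r | decide (r ∈ A) = y} else Set.univ
  have hs : (fun r : Fin l → R => (decide (r i ∈ A), decide (r j ∈ A))) ⁻¹' {(x, y)} =
      {r | ∀ k, r k ∈ s k} := by
    ext r
    simp only [Set.mem_preimage, Set.mem_singleton_iff, Prod.mk.injEq, Set.mem_ofPred_eq]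
    constructor
    · rintro ⟨hx, hy⟩ k
      by_cases hki : k = i
      · simpa [s, hki] using hx
      · by_cases hkj : k = j
        · simpa [s, hkj, hij.symm] using hy
        · simp [s, hki, hkj]
    · intro h
      exact ⟨by simpa [s] using h i, by simpa [s, hij.symm] using h j⟩
  rw [hs, pmfPi_toOuterMeasure_box, ← Finset.prod_subset (Finset.subset_univ {i, j}),
    Finset.prod_pair hij]
  · have hi : s i = {r | decide (r ∈ A) = x} := by simp [s]
    have hj : s j = {r | decide (r ∈ A) = y} := by simp [s, hij.symm]
    rw [hi, hj, uniform_toOuterMeasure_comp, uniform_toOuterMeasure_comp]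
    cases x <;> cases y <;> rfl
  · intro k _ hk
    have hk' : s k = Set.univ := by
      simp only [Finset.mem_insert, Finset.mem_singleton, not_or] at hk
      simp [s, hk.1, hk.2]
    rw [hk', PMF.toOuterMeasure_apply_eq_one_iff]
    exact Set.subset_univ _

/-! ### Indistinguishable executions have equivalent configurations -/

section Executions

theorem forall₂_exists_right {α β : Type*} {r : α → β → Prop} {x : List α} {y : List β}
    (h : List.Forall₂ r x y) {a : α} (ha : a ∈ x) : ∃ b ∈ y, r a b := by
  induction h with
  | nil => simp at ha
  | cons hab _ ih =>
    rcases List.mem_cons.1 ha with rfl | ha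
    · exact ⟨_, List.mem_cons_self, hab⟩
    · obtain ⟨b, hb, hr⟩ := ih ha
      exact ⟨b, List.mem_cons_of_mem _ hb, hr⟩

variable {U : Type uU} {R : Type uR} {Δ : Type uD} {l : ℕ}

theorem IOConfig.request_id (C : IOConfig U R Δ l) (u : U) (j : ℕ) :
    (C.request u j).id = C.id u := by
  cases j <;> rfl

variable [DecidableEq R]

/-- Agreement on the links that have a compromised end is agreement on the observed hops. -/
theorem IOConfig.hop_eq_of_observed {A : Finset R} {C D : IOConfig U R Δ l} {u v : U}
    (h : ∀ j ≤ l, isComp A (C.hop u j) ∨ isComp A (C.hop u (j + 1)) →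
      C.hop u j = D.hop v j ∧ C.hop u (j + 1) = D.hop v (j + 1))
    {j : ℕ} (hj : j ≤ l + 1) (ho : C.Observed A u j) : C.hop u j = D.hop v j := by
  rcases ho with ho | ho | ⟨i, rfl, ho⟩
  · rcases hj.lt_or_eq with hj | rfl
    · exact (h j (Nat.lt_succ_iff.1 hj) (.inl ho)).1
    · simp [IOConfig.hop, isComp] at ho
  · rcases hj.lt_or_eq with hj | rfl
    · exact (h j (Nat.lt_succ_iff.1 hj) (.inr ho)).1
    · simp [IOConfig.hop, isComp] at ho
  · exact (h i (Nat.succ_le_succ_iff.1 hj) (.inl ho)).2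

variable [DecidableEq U] [DecidableEq Δ]

theorem State.deliver_chan (C : IOConfig U R Δ l) (A : Finset R) (s : State U R Δ)
    (q r : Agent U R Δ) (m : Packet U R Δ) : (s.deliver C A q r m).chan = s.chan := by
  unfold State.deliver
  split_ifs
  · rfl
  · cases r <;> rfl

theorem mem_setChan_chan {s : State U R Δ} {q r q' r' : Agent U R Δ}
    {x : List (Packet U R Δ)} {m : Packet U R Δ} (h : m ∈ (s.setChan q r x).chan q' r') :
    q' = q ∧ r' = r ∧ m ∈ x ∨ m ∈ s.chan q' r' := by
  by_cases hq : q' = q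
  · subst hq
    by_cases hr : r' = r
    · subst hr
      left
      simpa [State.setChan] using h
    · right
      simpa [State.setChan, hr] using h
  · right
    simpa [State.setChan, hq] using h

/-- A packet in a channel after a step was there before or has just been sent. -/
theorem Step.mem_chan {C : IOConfig U R Δ l} {A : Finset R} {s s' : State U R Δ}
    {a : Action U R Δ} (h : Step C A s a s') {q r : Agent U R Δ} {m : Packet U R Δ}
    (hm : m ∈ s'.chan q r) : m ∈ s.chan q r ∨ a = .send q r m := by
  cases h with
  | start u hu => exact .inl hm
  | send q₀ r₀ m₀ rest hq ho =>
    rcases mem_setChan_chan hm with ⟨rfl, rfl, h⟩ | h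
    · rcases List.mem_append.1 h with h | h
      · exact .inl h
      · rw [List.mem_singleton.1 h]
        exact .inr rfl
    · exact .inl h
  | inject q₀ r₀ m₀ hq hd =>
    rcases mem_setChan_chan hm with ⟨rfl, rfl, h⟩ | h
    · rcases List.mem_append.1 h with h | h
      · exact .inl h
      · rw [List.mem_singleton.1 h]
        exact .inr rfl
    · exact .inl h
  | receive q₀ r₀ m₀ rest hc =>
    rw [State.deliver_chan] at hm
    rcases mem_setChan_chan hm with ⟨rfl, rfl, h⟩ | h
    · rw [hc]
      exact .inl (List.mem_cons_of_mem _ h)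
    · exact .inl h

theorem Step.receive_mem_chan {C : IOConfig U R Δ l} {A : Finset R} {s s' : State U R Δ}
    {q r : Agent U R Δ} {m : Packet U R Δ} (h : Step C A s (.receive q r m) s') :
    m ∈ s.chan q r := by
  cases h with
  | receive q r m rest hc => simp [hc]

theorem IsRun.send_of_receive {C : IOConfig U R Δ l} {A : Finset R} {s : State U R Δ}
    {e : List (Action U R Δ × State U R Δ)} (h : IsRun C A s e) {q r : Agent U R Δ}
    {m : Packet U R Δ} (hm : Action.receive q r m ∈ e.map Prod.fst) :
    m ∈ s.chan q r ∨ Action.send q r m ∈ e.map Prod.fst := by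
  induction h with
  | nil s => simp at hm
  | cons hs _ ih =>
    rw [List.map_cons, List.mem_cons] at hm ⊢
    rcases hm with hm | hm
    · dsimp only at hm
      subst hm
      exact .inl hs.receive_mem_chan
    · rcases ih hm with h | h
      · rcases hs.mem_chan h with h | h
        · exact .inl h
        · exact .inr (.inl h.symm)
      · exact .inr (.inr h)

/-- All packets that users have sent or are about to send carry their circuit identifiers. -/
def State.UserIds (C : IOConfig U R Δ l) (s : State U R Δ) : Prop :=
  (∀ u x, x ∈ s.outbox (.user u) → x.2.id = C.id u) ∧
    ∀ u r m, m ∈ s.chan (.user u) r → m.id = C.id u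

theorem State.UserIds.deliver {C : IOConfig U R Δ l} {A : Finset R} {s : State U R Δ}
    (h : s.UserIds C) (q r : Agent U R Δ) (m : Packet U R Δ) :
    (s.deliver C A q r m).UserIds C := by
  refine ⟨fun u x hx => ?_, fun u r' m' hm => ?_⟩
  · unfold State.deliver at hx
    split_ifs at hx
    · exact h.1 u x hx
    · cases r with
      | user v =>
        by_cases huv : u = v
        · subst huv
          simp only [Function.update_self, List.mem_append] at hx
          rcases hx with hx | hx
          · exact h.1 u x hx
          · unfold IOConfig.userReact at hx
            split_ifs at hx
            · rw [List.mem_singleton.1 hx]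
              exact C.request_id u _
            all_goals simp at hx
        · have hne : (Agent.user u : Agent U R Δ) ≠ .user v := by simpa using huv
          simp only [Function.update_of_ne hne] at hx
          exact h.1 u x hx
      | router v => exact h.1 u x (by simpa using hx)
      | dest v => exact h.1 u x (by simpa using hx)
  · rw [State.deliver_chan] at hm
    exact h.2 u r' m' hm

theorem State.UserIds.step {C : IOConfig U R Δ l} {A : Finset R} {s s' : State U R Δ}
    {a : Action U R Δ} (h : s.UserIds C) (hs : Step C A s a s') : s'.UserIds C := by
  cases hs with
  | start v hv =>
    refine ⟨fun u x hx => ?_, h.2⟩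
    by_cases huv : u = v
    · subst huv
      simp only [Function.update_self, List.mem_append, List.mem_singleton] at hx
      rcases hx with hx | rfl
      · exact h.1 u x hx
      · rfl
    · have hne : (Agent.user u : Agent U R Δ) ≠ .user v := by simpa using huv
      simp only [Function.update_of_ne hne] at hx
      exact h.1 u x hx
  | send q₀ r₀ m₀ rest hq ho =>
    refine ⟨fun u x hx => ?_, fun u r m hm => ?_⟩
    · by_cases hu : Agent.user u = q₀
      · subst hu
        simp only [Function.update_self] at hx
        exact h.1 u x (ho ▸ List.mem_cons_of_mem _ hx)
      · simp only [Function.update_of_ne hu] at hx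
        exact h.1 u x hx
    · rcases mem_setChan_chan hm with ⟨rfl, rfl, h'⟩ | h'
      · rcases List.mem_append.1 h' with h' | h'
        · exact h.2 u _ m h'
        · rw [List.mem_singleton.1 h']
          exact h.1 u (r, m₀) (ho ▸ List.mem_cons_self)
      · exact h.2 u r m h'
  | inject q₀ r₀ m₀ hq hd =>
    refine ⟨h.1, fun u r m hm => ?_⟩
    rcases mem_setChan_chan hm with ⟨rfl, rfl, _⟩ | h'
    · simp [isComp] at hq
    · exact h.2 u r m h'
  | receive q₀ r₀ m₀ rest hc =>
    refine State.UserIds.deliver (s := s.setChan q₀ r₀ rest) ⟨h.1, fun u r m hm => ?_⟩ _ _ _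
    rcases mem_setChan_chan hm with ⟨rfl, rfl, h'⟩ | h'
    · exact h.2 u _ m (hc ▸ List.mem_cons_of_mem _ h')
    · exact h.2 u r m h'

theorem IsRun.receive_user_id {C : IOConfig U R Δ l} {A : Finset R} {s : State U R Δ}
    {e : List (Action U R Δ × State U R Δ)} (h : IsRun C A s e) (hs : s.UserIds C) {u : U}
    {r : Agent U R Δ} {m : Packet U R Δ}
    (hm : Action.receive (.user u) r m ∈ e.map Prod.fst) : m.id = C.id u := by
  induction h with
  | nil s => simp at hm
  | cons hst _ ih =>
    rw [List.map_cons, List.mem_cons] at hm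
    rcases hm with hm | hm
    · dsimp only at hm
      subst hm
      exact hs.2 u r m hst.receive_mem_chan
    · exact ih (hs.step hst) hm

theorem Execution.send_of_receive {A : Finset R} (e : Execution U R Δ l A) {q r : Agent U R Δ}
    {m : Packet U R Δ} (hm : Action.receive q r m ∈ e.actions) :
    Action.send q r m ∈ e.actions := by
  rcases e.isRun.send_of_receive hm with h | h
  · simp [State.init] at h
  · exact h

theorem Execution.receive_user_id {A : Finset R} (e : Execution U R Δ l A) {u : U}
    {r : Agent U R Δ} {m : Packet U R Δ} (hm : Action.receive (.user u) r m ∈ e.actions) :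
    m.id = e.config.id u :=
  e.isRun.receive_user_id ⟨by simp [State.init], by simp [State.init]⟩ hm

/-- Where one end of a link is compromised, the adversary sees the packet that creates the next
hop, at the recipient or at the sender. -/
theorem Execution.Established.exists_visible {A : Finset R} {e : Execution U R Δ l A}
    (h : e.Established) {u : U} {j : ℕ} (hj : j ≤ l)
    (hc : isComp A (e.config.hop u j) ∨ isComp A (e.config.hop u (j + 1))) :
    ∃ m : Packet U R Δ, m.dir = .fwd ∧
      e.config.Carries u j (e.config.hop u j) (e.config.hop u (j + 1)) m ∧
      ∃ a ∈ e.visible, a = .send (e.config.hop u j) (e.config.hop u (j + 1)) m ∨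
        a = .receive (e.config.hop u j) (e.config.hop u (j + 1)) m := by
  obtain ⟨n, hn⟩ := h u j hj
  refine ⟨⟨n, .fwd, .enc (e.config.key u (j + 1)) .create⟩, rfl,
    ⟨⟨e.config.key u (j + 1), .create, rfl, rfl⟩, rfl, rfl⟩, ?_⟩
  rcases hc with hc | hc
  · exact ⟨_, List.mem_filter.2 ⟨e.send_of_receive hn, hc⟩, .inl rfl⟩
  · exact ⟨_, List.mem_filter.2 ⟨hn, hc⟩, .inr rfl⟩

/-- Every link with a compromised end carries a visible packet, whose sender and recipient are
preserved by the relabelling, and so are its circuit and link. -/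
theorem Execution.Indist.config_equiv {A : Finset R} {e e' : Execution U R Δ l A}
    (h : e.Indist e') (he : e.Established) (he' : e'.Established) :
    e.config.Equiv A e'.config := by
  obtain ⟨ρ, hρ⟩ := h
  have hCD : ∀ u, ∀ j ≤ l,
      isComp A (e.config.hop u j) ∨ isComp A (e.config.hop u (j + 1)) →
      e.config.hop u j = e'.config.hop (ρ.π u) j ∧
        e.config.hop u (j + 1) = e'.config.hop (ρ.π u) (j + 1) := by
    intro u j hj hc
    obtain ⟨m, hm, hcar, a, ha, hlink⟩ := he.exists_visible hj hc
    obtain ⟨a', -, rfl, hon⟩ := forall₂_exists_right hρ ha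
    have h1 := hon u j hj
    rcases hlink with rfl | rfl
    all_goals
      have h2 := (h1.1 hcar).2
      simp only [hm] at h2
      exact h2
  have hDC : ∀ u, ∀ j ≤ l,
      isComp A (e'.config.hop (ρ.π u) j) ∨ isComp A (e'.config.hop (ρ.π u) (j + 1)) →
      e'.config.hop (ρ.π u) j = e.config.hop u j ∧
        e'.config.hop (ρ.π u) (j + 1) = e.config.hop u (j + 1) := by
    intro u j hj hc
    obtain ⟨m, hm, hcar, a', ha', hlink⟩ := he'.exists_visible hj hc
    obtain ⟨a, -, rfl, hon⟩ := forall₂_exists_right hρ.flip ha'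
    have h1 := hon u j hj
    rcases hlink with hl | hl
    all_goals
      rw [hl] at h1
      have h2 := h1.2 hcar
      cases a with
      | start v => exact h2.elim
      | send q r m₀ =>
        simp only [Relabelling.act, Action.send.injEq, reduceCtorEq] at hl
        try
          obtain ⟨hq, hr, rfl⟩ := hl
          have h3 := h2.2
          dsimp only at hm
          simp only [hm] at h3
          exact ⟨hq.symm.trans h3.1, hr.symm.trans h3.2⟩
      | receive q r m₀ =>
        simp only [Relabelling.act, Action.receive.injEq, reduceCtorEq] at hl
        try
          obtain ⟨hq, hr, rfl⟩ := hl
          have h3 := h2.2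
          dsimp only at hm
          simp only [hm] at h3
          exact ⟨hq.symm.trans h3.1, hr.symm.trans h3.2⟩
  refine ⟨ρ.π, fun u j hj ho => ?_, fun u hu => ?_⟩
  · rcases ho with ho | ho
    · exact IOConfig.hop_eq_of_observed (hCD u) hj ho
    · exact (IOConfig.hop_eq_of_observed (hDC u) hj ho).symm
  · obtain ⟨n, hn⟩ := he u 0 l.zero_le
    obtain ⟨a', ha', rfl, -⟩ := forall₂_exists_right hρ
      (List.mem_filter.2 ⟨hn, by simpa [Action.isVisible] using hu⟩)
    have hπ : u = ρ.π u := by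
      simpa [IOConfig.hop] using (hCD u 0 l.zero_le (.inr hu)).1
    have h1 := e.receive_user_id hn
    have h2 := e'.receive_user_id (List.mem_filter.1 ha').1
    rw [← hπ]
    exact h1.symm.trans h2

theorem Execution.Indist.refl {A : Finset R} (e : Execution U R Δ l A) : e.Indist e := by
  refine ⟨⟨1, 1, rfl, rfl, rfl, fun _ _ => rfl, fun _ _ _ => rfl,
    fun k p hk => ⟨k, p, rfl, rfl, hk⟩⟩, ?_⟩
  refine List.forall₂_same.2 fun a _ => ⟨?_, fun _ _ _ => Iff.rfl⟩
  cases a <;> rfl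

/-- What the adversary learns from the actions about the destinations is what he learns from the
equivalence class of the configuration. -/
theorem ioPosterior_eq_condProb_config {A : Finset R} {μ : PMF (Execution U R Δ l A)}
    (hpaired : PairedEqually μ) (hest : ∀ e ∈ μ.support, e.Established)
    {e : Execution U R Δ l A} (he : e ∈ μ.support) (u : U) (d : Δ) :
    ioPosterior μ u d e =
      condProb (μ.map Execution.config) {C | C.dest u = d} {D | e.config.Equiv A D} := by
  have hEe := toOuterMeasure_ne_zero_of_mem he
    (show e ∈ {x | e.Indist x} ∩ Execution.config ⁻¹' {e.config} from ⟨.refl e, rfl⟩)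
  have he0 := toOuterMeasure_ne_zero_of_mem he
    (show e ∈ Execution.config ⁻¹' {e.config} from rfl)
  refine condProb_preimage_eq μ Execution.config {x | e.Indist x} {D | e.config.Equiv A D}
    (μ.toOuterMeasure ({x | e.Indist x} ∩ Execution.config ⁻¹' {e.config}) /
      μ.toOuterMeasure (Execution.config ⁻¹' {e.config}))
    (ENNReal.div_ne_zero.2 ⟨hEe, toOuterMeasure_ne_top _ _⟩)
    (ENNReal.div_ne_top (toOuterMeasure_ne_top _ _) he0) ?_ ?_ {C | C.dest u = d}
  · intro D hD
    by_cases hD0 : μ.toOuterMeasure (Execution.config ⁻¹' {D}) = 0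
    · rw [hD0, mul_zero]
      exact le_antisymm ((μ.toOuterMeasure.mono Set.inter_subset_right).trans hD0.le) zero_le
    · have h := hpaired e.config D hD
        (ENNReal.toReal_ne_zero.2 ⟨he0, toOuterMeasure_ne_top _ _⟩)
        (ENNReal.toReal_ne_zero.2 ⟨hD0, toOuterMeasure_ne_top _ _⟩) e
      have hfib : ∀ C, {x : Execution U R Δ l A | x.config = C} = Execution.config ⁻¹' {C} :=
        fun C => rfl
      simp only [condProb, prob, ← ENNReal.toReal_div, hfib] at h
      rw [ENNReal.toReal_eq_toReal_iff'
        (ENNReal.div_ne_top (toOuterMeasure_ne_top _ _) he0)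
        (ENNReal.div_ne_top (toOuterMeasure_ne_top _ _) hD0)] at h
      exact ((congrArg (· * μ.toOuterMeasure (Execution.config ⁻¹' {D})) h).trans
        (ENNReal.div_mul_cancel hD0 (toOuterMeasure_ne_top _ _))).symm
  · intro D hD
    rw [PMF.toOuterMeasure_apply_eq_zero_iff, Set.disjoint_left]
    rintro x hx ⟨hex, rfl⟩
    exact hD (hex.config_equiv (hest e he) (hest x hx))

end Executions

/-! ### The law of routers and identifiers -/

section CircuitLaw

variable {U : Type uU} {R : Type uR} {Δ : Type uD} {l : ℕ} [Fintype U] [DecidableEq U]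
  [Fintype R] [Nonempty R]

/-- The law of the routers and identifiers. -/
noncomputable def circuitLaw (U : Type uU) (R : Type uR) [Fintype U] [DecidableEq U] [Fintype R]
    [Nonempty R] (l : ℕ) (ρ : PMF (U → ℕ+)) : PMF ((U → Fin l → R) × (U → ℕ+)) :=
  (pmfPi fun _ : U => pmfPi fun _ : Fin l => PMF.uniformOfFintype R).bind fun r =>
    ρ.map fun n => (r, n)

theorem ioConfigLaw_eq_bind [Fintype Δ] (p : U → PMF Δ) (ρ : PMF (U → ℕ+)) :
    ioConfigLaw (R := R) l p ρ =
      (pmfPi p).bind fun d => (circuitLaw U R l ρ).map fun x => ⟨x.1, d, x.2⟩ := by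
  rw [ioConfigLaw, PMF.bind_comm]
  refine congrArg _ (funext fun d => ?_)
  rw [circuitLaw, PMF.map_bind]
  refine congrArg _ (funext fun r => ?_)
  rw [PMF.map_comp]
  rfl

theorem circuitLaw_map_comp_perm (ρ : PMF (U → ℕ+)) (σ : Equiv.Perm U) :
    (circuitLaw U R l ρ).map (fun x => (x.1 ∘ σ, x.2)) = circuitLaw U R l ρ := by
  rw [circuitLaw, PMF.map_bind]
  conv_rhs => rw [← pmfPi_const_comp_perm _ σ, PMF.bind_map]
  refine congrArg _ (funext fun r => ?_)
  rw [PMF.map_comp]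
  rfl

end CircuitLaw

/-! ### Equivalent configurations -/

section Configurations

variable {U : Type uU} {R : Type uR} {Δ : Type uD} {l : ℕ} [DecidableEq R]

/-- The adversary recognizes which hops he observes. -/
theorem IOConfig.observed_of_hop_eq {A : Finset R} {C D : IOConfig U R Δ l} {u v : U}
    (h : ∀ j ≤ l + 1, C.Observed A u j → C.hop u j = D.hop v j) {j : ℕ} (hj : j ≤ l + 1)
    (ho : C.Observed A u j) : D.Observed A v j := by
  rcases ho with hc | hc | ⟨i, rfl, hc⟩
  · exact .inl (h j hj (.inl hc) ▸ hc)
  · have hj' : j + 1 ≤ l + 1 := by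
      by_contra hlt
      have hjl : ¬ j < l := by omega
      simp [IOConfig.hop, hjl, isComp] at hc
    exact .inr (.inl (h (j + 1) hj' (.inl hc) ▸ hc))
  · exact .inr (.inr ⟨i, rfl, h i (Nat.le_of_succ_le hj) (.inl hc) ▸ hc⟩)

theorem IOConfig.Equiv.symm {A : Finset R} {C D : IOConfig U R Δ l} (h : C.Equiv A D) :
    D.Equiv A C := by
  obtain ⟨π, hhop, hid⟩ := h
  refine ⟨π.symm, fun u j hj ho => ?_, fun u hu => ?_⟩
  · obtain ⟨v, rfl⟩ := π.surjective u
    rw [π.symm_apply_apply] at ho ⊢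
    exact (hhop v j hj ho.symm).symm
  · obtain ⟨v, rfl⟩ := π.surjective u
    rw [π.symm_apply_apply]
    have h1 : C.hop v 1 = D.hop (π v) 1 := hhop v 1 (by omega) (.inr (.inl hu))
    exact (hid v (h1 ▸ hu)).symm

theorem IOConfig.Equiv.trans {A : Finset R} {C D E : IOConfig U R Δ l} (h : C.Equiv A D)
    (h' : D.Equiv A E) : C.Equiv A E := by
  obtain ⟨π, hhop, hid⟩ := h
  obtain ⟨π', hhop', hid'⟩ := h'
  refine ⟨π.trans π', fun u j hj ho => ?_, fun u hu => ?_⟩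
  · have hD : D.Observed A (π u) j := by
      rcases ho with ho | ho
      · exact observed_of_hop_eq (fun j hj ho => hhop u j hj (.inl ho)) hj ho
      · exact observed_of_hop_eq (fun j hj ho => (hhop' (π u) j hj (.inr ho)).symm) hj ho
    exact (hhop u j hj (.inr hD)).trans (hhop' (π u) j hj (.inl hD))
  · have h1 : C.hop u 1 = D.hop (π u) 1 := hhop u 1 (by omega) (.inl (.inl hu))
    exact (hid u hu).trans (hid' (π u) (h1 ▸ hu))

theorem IOConfig.Equiv.refl (A : Finset R) (C : IOConfig U R Δ l) : C.Equiv A C :=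
  ⟨1, fun _ _ _ _ => rfl, fun _ _ => rfl⟩

/-! ### From the automata to the black box -/

/-- The black-box configuration of a configuration of the automata: the input of a user is
observed when her first router is compromised, the output when her last router is. -/
def IOConfig.toBB (A : Finset R) (C : IOConfig U R Δ l) : BBConfig U Δ :=
  ⟨C.dest, fun u => isComp A (C.hop u 1), fun u => isComp A (C.hop u l)⟩

theorem BBConfig.indist_iff_exists_perm [Fintype U] {c c' : BBConfig U Δ} :
    c.Indist c' ↔ ∃ π : Equiv.Perm U, ∀ u, c.message u = c'.message (π u) := by
  classical
  constructor
  · intro h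
    have hcard : ∀ x,
        Fintype.card {u // c.message u = x} = Fintype.card {u // c'.message u = x} := by
      intro x
      have h' := congrArg (Multiset.count x) h
      rw [Multiset.count_map, Multiset.count_map] at h'
      rw [Fintype.card_subtype, Fintype.card_subtype, Finset.card_def, Finset.card_def,
        Finset.filter_val, Finset.filter_val]
      simpa only [eq_comm] using h'
    refine ⟨Equiv.ofFiberEquiv fun x => Fintype.equivOfCardEq (hcard x), fun u => ?_⟩
    exact (Equiv.ofFiberEquiv_map _ u).symm
  · rintro ⟨π, hπ⟩
    have hc : c.message = c'.message ∘ π := funext hπ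
    rw [BBConfig.Indist, hc, ← Multiset.map_map, Multiset.map_univ_val_equiv]

theorem BBConfig.message_eq_iff {c c' : BBConfig U Δ} {u v : U} :
    c.message u = c'.message v ↔
      (c.inObs u = c'.inObs v ∧ (c.inObs u = true → u = v)) ∧
        c.outObs u = c'.outObs v ∧ (c.outObs u = true → c.dest u = c'.dest v) := by
  unfold BBConfig.message
  cases c.inObs u <;> cases c'.inObs v <;> cases c.outObs u <;> cases c'.outObs v <;> simp

theorem IOConfig.Equiv.toBB_indist [Fintype U] {A : Finset R} {C D : IOConfig U R Δ l}
    (h : C.Equiv A D) : (C.toBB A).Indist (D.toBB A) := by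
  obtain ⟨π, hhop, -⟩ := h
  refine BBConfig.indist_iff_exists_perm.2 ⟨π, fun u => BBConfig.message_eq_iff.2 ?_⟩
  -- Corresponding hops that differ are both honest, as a compromised hop is observed.
  have hcomp : ∀ j ≤ l + 1, isComp A (C.hop u j) = isComp A (D.hop (π u) j) := by
    intro j hj
    by_cases ho : isComp A (C.hop u j) = true ∨ isComp A (D.hop (π u) j) = true
    · rw [hhop u j hj (ho.imp .inl .inl)]
    · simp only [not_or, Bool.not_eq_true] at ho
      rw [ho.1, ho.2]
  refine ⟨⟨hcomp 1 (by omega), fun hu => ?_⟩, hcomp l (by omega), fun hu => ?_⟩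
  · simpa [IOConfig.hop] using hhop u 0 (by omega) (.inl (.inr (.inl hu)))
  · simpa [IOConfig.hop, IOConfig.toBB] using
      hhop u (l + 1) le_rfl (.inl (.inr (.inr ⟨l, rfl, hu⟩)))

/-- Circuits can be handed on from users to users whose black-box messages are the same. -/
theorem IOConfig.equiv_of_message_eq {A : Finset R} (hl : 1 ≤ l) {r : U → Fin l → R}
    {d : U → Δ} {n : U → ℕ+} {c : BBConfig U Δ} {π : Equiv.Perm U}
    (hc : ∀ u, ((⟨r, d, n⟩ : IOConfig U R Δ l).toBB A).message u = c.message (π u)) :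
    (⟨r, d, n⟩ : IOConfig U R Δ l).Equiv A ⟨r ∘ π.symm, c.dest, n⟩ := by
  have hr : ∀ u j, j + 1 ≤ l →
      (⟨r, d, n⟩ : IOConfig U R Δ l).hop u (j + 1) =
        (⟨r ∘ π.symm, c.dest, n⟩ : IOConfig U R Δ l).hop (π u) (j + 1) := by
    intro u j hj
    have hj' : j < l := hj
    simp [IOConfig.hop, hj']
  have hout : ∀ u, isComp A ((⟨r, d, n⟩ : IOConfig U R Δ l).hop u l) = true →
      d u = c.dest (π u) := fun u hu => (BBConfig.message_eq_iff.1 (hc u)).2.2 hu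
  have hin : ∀ u, isComp A ((⟨r, d, n⟩ : IOConfig U R Δ l).hop u 1) = true →
      u = π u := fun u hu => (BBConfig.message_eq_iff.1 (hc u)).1.2 hu
  have hcomp : ∀ u j, j ≤ l →
      isComp A ((⟨r, d, n⟩ : IOConfig U R Δ l).hop u j) =
        isComp A ((⟨r ∘ π.symm, c.dest, n⟩ : IOConfig U R Δ l).hop (π u) j) := by
    intro u j hj
    cases j with
    | zero => rfl
    | succ j => rw [hr u j hj]
  refine ⟨π, fun u j hj ho => ?_, fun u hu => ?_⟩
  · rcases j with _ | j
    · have hu : isComp A ((⟨r, d, n⟩ : IOConfig U R Δ l).hop u 1) = true := by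
        rcases ho with (ho | ho | ⟨i, hi, -⟩) | (ho | ho | ⟨i, hi, -⟩)
        · simp [IOConfig.hop, isComp] at ho
        · exact ho
        · omega
        · simp [IOConfig.hop, isComp] at ho
        · rwa [hcomp u 1 hl]
        · omega
      exact congrArg Agent.user (hin u hu)
    · rcases hj.lt_or_eq with hj | hj
      · exact hr u j (Nat.lt_succ_iff.1 hj)
      · obtain rfl : j = l := by omega
        have hu : isComp A ((⟨r, d, n⟩ : IOConfig U R Δ j).hop u j) = true := by
          rcases ho with (ho | ho | ⟨i, hi, ho⟩) | (ho | ho | ⟨i, hi, ho⟩)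
          · simp [IOConfig.hop, isComp] at ho
          · simp [IOConfig.hop, isComp] at ho
          · obtain rfl : j = i := by omega
            exact ho
          · simp [IOConfig.hop, isComp] at ho
          · simp [IOConfig.hop, isComp] at ho
          · obtain rfl : j = i := by omega
            rwa [hcomp u j le_rfl]
        simpa [IOConfig.hop] using hout u hu
  · exact congrArg n (hin u hu)

theorem IOConfig.toBB_comp_perm {A : Finset R} (hl : 1 ≤ l) {r : U → Fin l → R}
    {d : U → Δ} {n : U → ℕ+} {c : BBConfig U Δ} {π : Equiv.Perm U}
    (hc : ∀ u, ((⟨r, d, n⟩ : IOConfig U R Δ l).toBB A).message u = c.message (π u)) :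
    (⟨r ∘ π.symm, c.dest, n⟩ : IOConfig U R Δ l).toBB A = c := by
  have hr : ∀ u j, 1 ≤ j → j ≤ l →
      (⟨r, d, n⟩ : IOConfig U R Δ l).hop u j =
        (⟨r ∘ π.symm, c.dest, n⟩ : IOConfig U R Δ l).hop (π u) j := by
    intro u j hj hj'
    obtain ⟨j, rfl⟩ := Nat.exists_eq_succ_of_ne_zero (Nat.one_le_iff_ne_zero.1 hj)
    have hj'' : j < l := hj'
    simp [IOConfig.hop, hj'']
  obtain ⟨dest, inObs, outObs⟩ := c
  simp only [IOConfig.toBB, BBConfig.mk.injEq, true_and]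
  constructor <;> funext v <;> obtain ⟨u, rfl⟩ := π.surjective v
  · rw [← hr u 1 le_rfl hl]
    exact (BBConfig.message_eq_iff.1 (hc u)).1.1
  · rw [← hr u l hl le_rfl]
    exact (BBConfig.message_eq_iff.1 (hc u)).2.1

/-! ### The law of the configuration -/

variable [Fintype U] [DecidableEq U] [Fintype R] [Nonempty R]

/-- For a union `S` of equivalence classes, the probability that circuits complete a black-box
configuration to an element of `S` depends only on what the black-box adversary receives: handing
the circuits on along a permutation of the users preserves their law. -/
theorem circuitLaw_fiber_eq {A : Finset R} (hl : 1 ≤ l) (ρ : PMF (U → ℕ+))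
    {S : Set (IOConfig U R Δ l)} (hS : ∀ C D, C.Equiv A D → (C ∈ S ↔ D ∈ S))
    {c c' : BBConfig U Δ} (hc : c.Indist c') :
    (circuitLaw U R l ρ).toOuterMeasure
        {x | (⟨x.1, c.dest, x.2⟩ : IOConfig U R Δ l) ∈ S ∩ IOConfig.toBB A ⁻¹' {c}} =
      (circuitLaw U R l ρ).toOuterMeasure
        {x | (⟨x.1, c'.dest, x.2⟩ : IOConfig U R Δ l) ∈ S ∩ IOConfig.toBB A ⁻¹' {c'}} := by
  obtain ⟨π, hπ⟩ := BBConfig.indist_iff_exists_perm.1 hc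
  conv_rhs => rw [← circuitLaw_map_comp_perm ρ π.symm, PMF.toOuterMeasure_map_apply]
  congr 1
  ext ⟨r, n⟩
  simp only [Set.mem_inter_iff, Set.mem_preimage, Set.mem_singleton_iff, Set.mem_ofPred_eq]
  constructor
  · rintro ⟨hx, hcx⟩
    have hm : ∀ u, ((⟨r, c.dest, n⟩ : IOConfig U R Δ l).toBB A).message u =
        c'.message (π u) := fun u => by rw [hcx, hπ]
    exact ⟨(hS _ _ (IOConfig.equiv_of_message_eq hl hm)).1 hx, IOConfig.toBB_comp_perm hl hm⟩
  · rintro ⟨hx, hcx⟩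
    have hm : ∀ u, ((⟨r ∘ π.symm, c'.dest, n⟩ : IOConfig U R Δ l).toBB A).message u =
        c.message (π.symm u) := fun u => by rw [hcx, hπ, π.apply_symm_apply]
    have h1 := IOConfig.equiv_of_message_eq hl hm
    have h2 := IOConfig.toBB_comp_perm hl hm
    have hr : (r ∘ π.symm) ∘ π.symm.symm = r := by
      funext u
      simp
    rw [hr] at h1 h2
    exact ⟨(hS _ _ h1).1 hx, h2⟩

variable [Fintype Δ]

theorem ioConfigLaw_toOuterMeasure_inter_fiber {A : Finset R} (p : U → PMF Δ)
    (ρ : PMF (U → ℕ+)) (S : Set (IOConfig U R Δ l)) (c : BBConfig U Δ) :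
    (ioConfigLaw l p ρ).toOuterMeasure (S ∩ IOConfig.toBB A ⁻¹' {c}) =
      pmfPi p c.dest * (circuitLaw U R l ρ).toOuterMeasure
        {x | (⟨x.1, c.dest, x.2⟩ : IOConfig U R Δ l) ∈ S ∩ IOConfig.toBB A ⁻¹' {c}} := by
  rw [ioConfigLaw_eq_bind, PMF.toOuterMeasure_bind_apply, tsum_eq_single c.dest]
  · rw [PMF.toOuterMeasure_map_apply]
    rfl
  · intro d hd
    rw [PMF.toOuterMeasure_map_apply]
    have h : (fun x : (U → Fin l → R) × (U → ℕ+) => (⟨x.1, d, x.2⟩ : IOConfig U R Δ l)) ⁻¹'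
        (S ∩ IOConfig.toBB A ⁻¹' {c}) = ∅ := by
      ext x
      simp only [Set.mem_preimage, Set.mem_inter_iff, Set.mem_singleton_iff,
        Set.mem_empty_iff_false, iff_false, not_and]
      rintro - rfl
      exact hd rfl
    simp [h]

/-- What the adversary learns from the equivalence class of the configuration about the
destinations is what he learns from the messages of the black box. -/
theorem condProb_equiv_eq_bbPosterior {A : Finset R} (hl : 1 ≤ l) (p : U → PMF Δ)
    (ρ : PMF (U → ℕ+)) {C : IOConfig U R Δ l} (hC : C ∈ (ioConfigLaw l p ρ).support)
    (u : U) (d : Δ) :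
    condProb (ioConfigLaw l p ρ) {D | D.dest u = d} {D | C.Equiv A D} =
      bbPosterior ((ioConfigLaw l p ρ).map (IOConfig.toBB A)) u d (C.toBB A) := by
  have hSC := toOuterMeasure_ne_zero_of_mem hC
    (show C ∈ {D | C.Equiv A D} ∩ IOConfig.toBB A ⁻¹' {C.toBB A} from ⟨.refl A C, rfl⟩)
  have huC := toOuterMeasure_ne_zero_of_mem hC
    (show C ∈ Set.univ ∩ IOConfig.toBB A ⁻¹' {C.toBB A} from ⟨Set.mem_univ C, rfl⟩)
  rw [ioConfigLaw_toOuterMeasure_inter_fiber] at hSC huC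
  have hS0 := right_ne_zero_of_mul hSC
  have hu0 := right_ne_zero_of_mul huC
  refine condProb_preimage_eq (ioConfigLaw l p ρ) (IOConfig.toBB A) {D | C.Equiv A D}
    {c | (C.toBB A).Indist c} _
    (ENNReal.div_ne_zero.2 ⟨hS0, toOuterMeasure_ne_top _ _⟩)
    (ENNReal.div_ne_top (toOuterMeasure_ne_top _ _) hu0) ?_ ?_ {c | c.dest u = d}
  · intro c hc
    rw [← Set.univ_inter (IOConfig.toBB A ⁻¹' {c}), ← Set.inter_assoc, Set.inter_univ,
      ioConfigLaw_toOuterMeasure_inter_fiber, ioConfigLaw_toOuterMeasure_inter_fiber,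
      ← circuitLaw_fiber_eq hl ρ (S := {D | C.Equiv A D})
        (fun D E h => ⟨fun h' => h'.trans h, fun h' => h'.trans h.symm⟩) hc,
      ← circuitLaw_fiber_eq hl ρ (S := Set.univ) (fun _ _ _ => Iff.rfl) hc, mul_left_comm,
      ENNReal.div_mul_cancel hu0 (toOuterMeasure_ne_top _ _)]
  · intro c hc
    have h : {D | C.Equiv A D} ∩ IOConfig.toBB A ⁻¹' {c} = ∅ := by
      ext D
      simp only [Set.mem_inter_iff, Set.mem_preimage, Set.mem_singleton_iff,
        Set.mem_empty_iff_false, iff_false, not_and]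
      rintro h rfl
      exact hc (IOConfig.Equiv.toBB_indist h)
    simp [h]

/-- The black box is the image of the configuration: a router is compromised with probability
`|A| / |R|`, and the first and the last router are independent. -/
theorem ioConfigLaw_map_toBB (A : Finset R) (hl : 2 ≤ l) (p : U → PMF Δ) (ρ : PMF (U → ℕ+)) :
    (ioConfigLaw l p ρ).map (IOConfig.toBB A) =
      bbLaw (compFraction A) (compFraction_le_one A) p := by
  obtain ⟨k, rfl⟩ : ∃ k, l = k + 1 := ⟨l - 1, by omega⟩
  have hends : (⟨0, by omega⟩ : Fin (k + 1)) ≠ ⟨k, by omega⟩ := by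
    rw [Ne, Fin.mk.injEq]
    omega
  rw [ioConfigLaw, bbLaw, PMF.bind_comm, PMF.map_bind]
  refine congrArg _ (funext fun d => ?_)
  rw [PMF.map_bind, ← uniform_ends_map A hends, ← pmfPi_map, PMF.bind_map]
  refine congrArg _ (funext fun r => ?_)
  have h : (PMF.map (IOConfig.toBB A) ∘ fun n => PMF.pure (⟨r, d, n⟩ : IOConfig U R Δ (k + 1))) =
      fun _ : U → ℕ+ => PMF.pure
        (⟨d, fun u => decide (r u ⟨0, by omega⟩ ∈ A), fun u => decide (r u ⟨k, by omega⟩ ∈ A)⟩ :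
          BBConfig U Δ) := by
    funext n
    simp [PMF.pure_map, IOConfig.toBB, IOConfig.hop, isComp]
    rfl
  rw [PMF.map_bind]
  change ρ.bind (PMF.map (IOConfig.toBB A) ∘ fun n => PMF.pure ⟨r, d, n⟩) = _
  rw [h, PMF.bind_const]
  rfl

end Configurations

end OnionRouting

theorem theorem1 {U R Δ : Type*} [Fintype U] [DecidableEq U] [Fintype R] [DecidableEq R]
    [Nonempty R] [Fintype Δ] [DecidableEq Δ] (l : ℕ) (hl : 2 ≤ l) (A : Finset R)
    (p : U → PMF Δ) (ρ : PMF (U → ℕ+))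
    (μ : PMF (OnionRouting.Execution U R Δ l A))
    (hconfig : μ.map OnionRouting.Execution.config = OnionRouting.ioConfigLaw l p ρ)
    (hpaired : OnionRouting.PairedEqually μ)
    (hest : ∀ e ∈ μ.support, e.Established)
    (ψ₀ : U → Δ → ℝ) :
    OnionRouting.prob μ {e | ∀ u d, OnionRouting.ioPosterior μ u d e = ψ₀ u d} =
      OnionRouting.prob
        (OnionRouting.bbLaw (OnionRouting.compFraction A) (OnionRouting.compFraction_le_one A) p)
        {c | ∀ u d, OnionRouting.bbPosterior
          (OnionRouting.bbLaw (OnionRouting.compFraction A)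
            (OnionRouting.compFraction_le_one A) p) u d c = ψ₀ u d} := by
  rw [← OnionRouting.ioConfigLaw_map_toBB A hl p ρ, OnionRouting.prob_map, ← hconfig,
    OnionRouting.prob_map]
  refine OnionRouting.prob_congr fun e he => ?_
  have hC : e.config ∈ (OnionRouting.ioConfigLaw l p ρ).support := by
    rw [← hconfig, PMF.mem_support_map_iff]
    exact ⟨e, he, rfl⟩
  refine forall_congr' fun u => forall_congr' fun d => ?_
  rw [OnionRouting.ioPosterior_eq_condProb_config hpaired hest he, hconfig,
    OnionRouting.condProb_equiv_eq_bbPosterior (by omega) p ρ hC]
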